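/- Let $(X,A,Y)\sim P$ take values in $\mathcal X\times\mathcal A\times\{0,1\}$ and let $\mathcal H$ be a class of measurable classifiers $h:\mathcal X\to\{0,1\}$. Put $\mathrm{acc}(h)=P(h(X)=Y)$ and let $$\Phi_{\mathrm{fair}}(h)=\Bigl|\sum_{j=1}^m \mathbb E\bigl[g_j(X,A,Y,h(X))\mid \mathcal E_j\bigr]\Bigr|,$$ where the $g_j$ are measurable with $|g_j|\le B$ and the $\mathcal E_j$ are events determined by $(X,A,Y)$ with $P(\mathcal E_j)\ge p>0$; assume $\Phi_{\mathrm{fair}}(h)\in[0,1]$ for all $h\in\mathcal H$. For $\psi\in[0,1]$ let $\tau^*_{\mathrm{fair}}(\psi)=\inf\{\Phi_{\mathrm{fair}}(h): h\in\mathcal H,\ \mathrm{acc}(h)\ge\psi\}$, with $\tau^*_{\mathrm{fair}}(\psi)=1$ if no $h\in\mathcal H$ has $\mathrm{acc}(h)\ge\psi$, and let $\Delta(h)=\Phi_{\mathrm{fair}}(h)-\tau^*_{\mathrm{fair}}(\mathrm{acc}(h))$. Let $\mathcal D_{\mathrm{tr}}$ consist of $n\ge1$ i.i.d. draws from $P$.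 Let $\widehat{\mathrm{acc}}(h)$ be the fraction of $\mathcal D_{\mathrm{tr}}$ that $h$ classifies correctly, and let $\widehat{\Phi_{\mathrm{fair}}}(h)$ be obtained from $\Phi_{\mathrm{fair}}(h)$ by replacing each conditional expectation by the average over the points of $\mathcal D_{\mathrm{tr}}$ lying in $\mathcal E_j$ (an empty average is $0$). Let $$\mathcal R_n(\mathcal H)=\mathbb E\Bigl[\sup_{h\in\mathcal H}\tfrac1n\sum_{i=1}^n\sigma_i h(X_i)\Bigr]$$ be the Rademacher complexity of $\mathcal H$, with $X_i$ i.i.d. copies of $X$ and $\sigma_i$ independent uniform signs (the expectation is an outer expectation if the supremum is not measurable). Assume that $\tau^*_{\mathrm{fair}}$ is $L$-Lipschitz on $[0,1]$ and that $\mathcal R_n(\mathcal H)\le C\,n^{-\gamma}$ with $C\ge0$ and $\gamma\le 1/2$. Then for all $\delta\in\mathbb R$ and $\eta\in(0,1)$, with probability at least $1-\eta$ over $\mathcal D_{\mathrm{tr}}$, every $h\in\mathcal H$ that minimises $\widehat{\Phi_{\mathrm{fair}}}$ over $\{h'\in\mathcal H:\widehat{\mathrm{acc}}(h')\ge\delta\}$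 satisfies $$\Delta(h)\le K\,\bigl(1+\log(1/\eta)\bigr)^{k}\,n^{-\gamma},$$ where the constants $K$ and $k\in\mathbb N$ depend only on $L,C,\gamma,B,p,m$. -/

import Mathlib

open MeasureTheory

noncomputable section

namespace FairTradeoff

/-- The numerical value in `{0, 1}` of a binary label. -/
def val (b : Bool) : ℝ := if b then 1 else 0

/-- Upper (outer) expectation `E*[f]`, the infimum of `E[g]` over integrable `g ≥ f`.
It is the usual expectation when `f` is integrable (`upperExpectation_eq_integral`), and it makes
sense for suprema over uncountable classes, which need not be measurable. -/
def upperExpectation {Ω : Type*} [MeasurableSpace Ω] (μ : Measure Ω) (f : Ω → ℝ) : ℝ :=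
  sInf {r : ℝ | ∃ g : Ω → ℝ, Integrable g μ ∧ (∀ ω, f ω ≤ g ω) ∧ ∫ ω, g ω ∂μ = r}

theorem upperExpectation_eq_integral {Ω : Type*} [MeasurableSpace Ω] (μ : Measure Ω) (f : Ω → ℝ)
    (hf : Integrable f μ) : upperExpectation μ f = ∫ ω, f ω ∂μ := by
  refine IsLeast.csInf_eq ⟨⟨f, hf, fun _ => le_rfl, rfl⟩, ?_⟩
  rintro r ⟨g, hg, hfg, rfl⟩
  exact integral_mono hf hg hfg

/-- Rademacher complexity `R_n(H) = E_σ E_x [ sup_{h ∈ H} (1/n) ∑ i, σ i * h (x i) ]` of a class of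
binary classifiers, with `σ` uniform on `{-1, 1}^n` and `x` an i.i.d. sample of size `n` from `μ`. -/
def rademacherComplexity {X : Type*} [MeasurableSpace X] (μ : Measure X) (H : Set (X → Bool))
    (n : ℕ) : ℝ :=
  (1 / (2 : ℝ) ^ n) * ∑ σ : Fin n → ℤˣ,
    upperExpectation (Measure.pi fun _ : Fin n => μ)
      (fun x => ⨆ h : H, (1 / (n : ℝ)) * ∑ i, ((σ i : ℤ) : ℝ) * val (h.1 (x i)))

/-- The data of a fairness violation
`Φ(h) = |∑ j, E[g_j(X, A, Y, h(X)) | E_j]|` with `m` terms; a data point is a triple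
`(X, A, Y)` with a binary label `Y`. -/
structure FairnessMetric (X A : Type*) [MeasurableSpace X] [MeasurableSpace A] (m : ℕ) where
  /-- The functions `g_j(x, a, y, h(x))`; the last argument is the prediction. -/
  g : Fin m → X × A × Bool → Bool → ℝ
  /-- The conditioning events, determined by `(X, A, Y)`. -/
  event : Fin m → Set (X × A × Bool)
  measurable_g : ∀ j b, Measurable fun z => g j z b
  measurableSet_event : ∀ j, MeasurableSet (event j)

variable {X A : Type*} [MeasurableSpace X] [MeasurableSpace A] {m : ℕ}

/-- Accuracy `P(h(X) = Y)`. -/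
def acc (P : Measure (X × A × Bool)) (h : X → Bool) : ℝ :=
  P.real {z | h z.1 = z.2.2}

/-- Fairness violation over the data distribution. -/
def fair (P : Measure (X × A × Bool)) (F : FairnessMetric X A m) (h : X → Bool) : ℝ :=
  |∑ j, ∫ z, F.g j z (h z.1) ∂(ProbabilityTheory.cond P (F.event j))|

/-- Empirical accuracy: the fraction of the sample that is classified correctly. -/
def empAcc {n : ℕ} (D : Fin n → X × A × Bool) (h : X → Bool) : ℝ :=
  (∑ i, if h (D i).1 = (D i).2.2 then (1 : ℝ) else 0) / n

open Classical in
/-- Empirical fairness violation: each conditional expectation is replaced by the average over the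
sample points that lie in the event (an average over no points is `0`). -/
def empFair {n : ℕ} (F : FairnessMetric X A m) (D : Fin n → X × A × Bool) (h : X → Bool) : ℝ :=
  |∑ j, (∑ i, if D i ∈ F.event j then F.g j (D i) (h (D i).1) else 0) /
    (∑ i, if D i ∈ F.event j then (1 : ℝ) else 0)|

open Classical in
/-- The optimal accuracy-fairness trade-off curve: the least fairness violation among classifiers
in `H` of accuracy at least `ψ`, and `1` if the accuracy `ψ` is unattainable. -/
def tradeoff (P : Measure (X × A × Bool)) (F : FairnessMetric X A m) (H : Set (X → Bool))
    (ψ : ℝ) : ℝ :=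
  if ∃ h ∈ H, ψ ≤ acc P h then sInf (fair P F '' {h | h ∈ H ∧ ψ ≤ acc P h}) else 1

/-- The suboptimality gap `Δ(h) = Φ(h) - τ*(acc(h))`. -/
def gap (P : Measure (X × A × Bool)) (F : FairnessMetric X A m) (H : Set (X → Bool))
    (h : X → Bool) : ℝ :=
  fair P F h - tradeoff P F H (acc P h)

/-- `h` minimises the empirical fairness violation over `H` subject to empirical accuracy at
least `δ`. -/
def IsEmpiricalMinimiser {n : ℕ} (F : FairnessMetric X A m) (H : Set (X → Bool)) (δ : ℝ)
    (D : Fin n → X × A × Bool) (h : X → Bool) : Prop :=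
  (h ∈ H ∧ δ ≤ empAcc D h) ∧ ∀ h' ∈ H, δ ≤ empAcc D h' → empFair F D h ≤ empFair F D h'

end FairTradeoff

end

/-! Suppose that empirical accuracy and empirical fairness violation are within α and β of their
true values, uniformly over H. The bound is then deterministic (`gap_le_of_uniform_close`). An
empirical minimiser h is, up to 2β, at least as fair as any h' of no smaller empirical accuracy, in
particular as any h' with acc(h') ≥ acc(h) + 2α. So Φ(h) ≤ τ*(acc(h) + 2α) + 2β, and Lipschitz
continuity moves the level back to acc(h) at cost 2Lα. If acc(h) + 2α > 1, level 1 is used instead: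
a classifier of true accuracy 1 almost surely has empirical accuracy 1
(`exists_measurableSet_competitor`).

Uniform closeness reduces to empirical means of 2m + 1 statistics: the correctness indicator and,
for each j, 1_{E_j} g_j and 1_{E_j}. Conditional means are ratios of these, with true denominator at
least p. Since predictions are binary, each statistic is affine in h(x) with a bounded coefficient.
Symmetrization, together with writing the coefficient as the mean of a random sign, bounds the
expected supremum of the deviations by the Rademacher complexity of H itself; McDiarmid's inequality
gives the tail.

The suprema need not be measurable, so the argument runs through measurable majorants. A least
majorant (`exists_measurable_cover`) inherits bounded differences only almost everywhere, which is
why McDiarmid's inequality is proved in that form. -/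

namespace FairTradeoff

/-! ### Bounded differences almost everywhere. -/

/-- The law of `Fin.cons` of two independent parts of an i.i.d. sample. -/
theorem measurePreserving_cons {Z : Type*} [MeasurableSpace Z] (P : Measure Z)
    [IsProbabilityMeasure P] (n : ℕ) :
    MeasurePreserving (fun q : Z × (Fin n → Z) => (Fin.cons q.1 q.2 : Fin (n + 1) → Z))
      (P.prod (Measure.pi fun _ => P)) (Measure.pi fun _ => P) := by
  have h := (measurePreserving_piFinSuccAbove (fun _ : Fin (n + 1) => P) 0).symm
  convert h using 1
  ext q i
  simp [MeasurableEquiv.piFinSuccAbove, Fin.insertNthEquiv]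

/-- Regroups a sample and a replacement point as the tail, the first point and the replacement, so
that null sets in the bounded difference hypothesis can be sliced by Fubini. -/
theorem measurePreserving_cons_resample {Z : Type*} [MeasurableSpace Z] (P : Measure Z)
    [IsProbabilityMeasure P] (n : ℕ) :
    MeasurePreserving
      (fun q : (Fin n → Z) × Z × Z => ((Fin.cons q.2.1 q.1 : Fin (n + 1) → Z), q.2.2))
      ((Measure.pi fun _ : Fin n => P).prod (P.prod P))
      ((Measure.pi fun _ : Fin (n + 1) => P).prod P) := by
  have h1 := (measurePreserving_prodAssoc (Measure.pi fun _ : Fin n => P) P P).symm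
  have h2 := (Measure.measurePreserving_swap (μ := Measure.pi fun _ : Fin n => P) (ν := P)).prod
    (MeasurePreserving.id P)
  have h3 := (measurePreserving_cons P n).prod (MeasurePreserving.id P)
  exact h3.comp (h2.comp h1)

theorem integrable_of_measurable_of_abs_le {Ω : Type*} [MeasurableSpace Ω] {μ : Measure Ω}
    [IsFiniteMeasure μ] {f : Ω → ℝ} (hf : Measurable f) {b : ℝ} (hb : ∀ ω, |f ω| ≤ b) :
    Integrable f μ :=
  .of_bound hf.aestronglyMeasurable b (.of_forall hb)

/-- The bounded differences inequality for the moment generating function, where the differences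
are only assumed to be bounded almost everywhere. -/
theorem integral_exp_le_of_bounded_differences {Z : Type*} [MeasurableSpace Z] (P : Measure Z)
    [IsProbabilityMeasure P] (c b t : ℝ) (n : ℕ) (f : (Fin n → Z) → ℝ) (hf : Measurable f)
    (hb : ∀ z, |f z| ≤ b)
    (hd : ∀ i, ∀ᵐ q ∂(Measure.pi fun _ : Fin n => P).prod P,
      f q.1 ≤ f (Function.update q.1 i q.2) + c) :
    ∫ z, Real.exp (t * (f z - ∫ y, f y ∂Measure.pi fun _ : Fin n => P))
      ∂(Measure.pi fun _ : Fin n => P) ≤ Real.exp (n * c ^ 2 * t ^ 2 / 2) := by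
  induction n with
  | zero =>
    have : ∀ z, f z = f default := fun z => congrArg f (Subsingleton.elim _ _)
    simp [this]
  | succ n ih =>
    have hmc := (measurePreserving_cons P n).measurable
    have hint : ∀ zr : Fin n → Z, Integrable (fun w => f (Fin.cons w zr)) P := fun zr =>
      integrable_of_measurable_of_abs_le
        (hf.comp (hmc.comp (measurable_id.prodMk measurable_const))) fun _ => hb _
    -- The first coordinate is integrated out. The average inherits the bounded differences in the
    -- remaining coordinates, and the fluctuation around it is handled by Hoeffding's lemma in one
    -- variable.
    set f₁ : (Fin n → Z) → ℝ := fun zr => ∫ w, f (Fin.cons w zr) ∂P with hf₁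
    have hf₁m : Measurable f₁ := by
      have : StronglyMeasurable fun q : (Fin n → Z) × Z => f (Fin.cons q.2 q.1) :=
        (hf.comp (hmc.comp measurable_swap)).stronglyMeasurable
      exact this.integral_prod_right.measurable
    have hf₁b : ∀ zr, |f₁ zr| ≤ b := fun zr => by
      simpa using norm_integral_le_of_norm_le_const (μ := P) (f := fun w => f (Fin.cons w zr))
        (.of_forall fun w => hb _)
    have hmean : ∫ y, f y ∂(Measure.pi fun _ : Fin (n + 1) => P)
        = ∫ y, f₁ y ∂(Measure.pi fun _ : Fin n => P) := by
      rw [← (measurePreserving_cons P n).map_eq,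
        integral_map hmc.aemeasurable hf.aestronglyMeasurable, integral_prod_symm]
      exact integrable_of_measurable_of_abs_le (hf.comp hmc) fun _ => hb _
    have hΨ := measurePreserving_cons_resample P n
    have hd₁ : ∀ i, ∀ᵐ q ∂(Measure.pi fun _ : Fin n => P).prod P,
        f₁ q.1 ≤ f₁ (Function.update q.1 i q.2) + c := by
      intro i
      have h1 := measurePreserving_prodAssoc (Measure.pi fun _ : Fin n => P) P P
      have h2 := (MeasurePreserving.id (Measure.pi fun _ : Fin n => P)).prod
        (Measure.measurePreserving_swap (μ := P) (ν := P))
      have h := (hΨ.comp (h2.comp h1)).quasiMeasurePreserving.ae (hd i.succ)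
      filter_upwards [Measure.ae_ae_of_ae_prod h] with q hq
      have hc : ∫ _, c ∂P = c := by simp
      rw [hf₁, ← hc, ← integral_add (hint _) (integrable_const c)]
      refine integral_mono_ae (hint _) ((hint _).add (integrable_const c)) ?_
      filter_upwards [hq] with w hw
      rw [Fin.cons_update]
      exact hw
    have hinner : ∀ᵐ zr ∂(Measure.pi fun _ : Fin n => P),
        ∫ w, Real.exp (t * (f (Fin.cons w zr) - f₁ zr)) ∂P ≤ Real.exp (c ^ 2 * t ^ 2 / 2) := by
      have h := Measure.ae_ae_of_ae_prod (hΨ.quasiMeasurePreserving.ae (hd 0))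
      filter_upwards [h] with zr hzr
      have hzr' := (Measure.measurePreserving_swap (μ := P) (ν := P)).quasiMeasurePreserving.ae hzr
      -- A reference point a for which both exchange inequalities hold against almost every w. The
      -- fibre then lies in an interval of width 2c centred at its value at a, so Hoeffding's lemma
      -- gives variance proxy c².
      obtain ⟨a, ha⟩ := (Measure.ae_ae_of_ae_prod (hzr.and hzr')).exists
      have hI : ∀ᵐ w ∂P, f (Fin.cons w zr) ∈
          Set.Icc (f (Fin.cons a zr) - c) (f (Fin.cons a zr) + c) := by
        filter_upwards [ha] with w hw
        simp only [Fin.update_cons_zero, Prod.fst_swap, Prod.snd_swap] at hw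
        constructor <;> linarith [hw.1, hw.2]
      have hs := (ProbabilityTheory.hasSubgaussianMGF_of_mem_Icc
        (hint zr).aestronglyMeasurable.aemeasurable hI).mgf_le t
      refine hs.trans (le_of_eq ?_)
      congr 1
      push_cast
      rw [show f (Fin.cons a zr) + c - (f (Fin.cons a zr) - c) = 2 * c by ring]
      rw [Real.norm_eq_abs, abs_mul, div_pow, mul_pow, sq_abs]
      norm_num
    have hexp : ∀ (x s : ℝ), |x| ≤ s → |Real.exp (t * x)| ≤ Real.exp (|t| * s) := by
      intro x s hx
      rw [abs_of_pos (Real.exp_pos _)]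
      refine Real.exp_le_exp.2 ((le_abs_self _).trans ?_)
      rw [abs_mul]
      gcongr
    set μ₁ := ∫ y, f₁ y ∂(Measure.pi fun _ : Fin n => P) with hμ₁
    have hsplit : ∀ w zr, Real.exp (t * (f (Fin.cons w zr) - μ₁)) =
        Real.exp (t * (f₁ zr - μ₁)) * Real.exp (t * (f (Fin.cons w zr) - f₁ zr)) := by
      intro w zr
      rw [← Real.exp_add]
      ring_nf
    have hμ₁b : |μ₁| ≤ b := by
      simpa using norm_integral_le_of_norm_le_const
        (μ := Measure.pi fun _ : Fin n => P) (f := f₁) (.of_forall hf₁b)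
    rw [hmean, ← (measurePreserving_cons P n).map_eq,
      integral_map hmc.aemeasurable (by fun_prop), integral_prod_symm]
    swap
    · refine integrable_of_measurable_of_abs_le (b := Real.exp (|t| * (b + b))) (by fun_prop) ?_
      intro q
      exact hexp _ _ ((abs_sub _ _).trans (add_le_add (hb _) hμ₁b))
    simp_rw [hsplit, integral_const_mul]
    calc _ ≤ ∫ zr, Real.exp (t * (f₁ zr - μ₁)) * Real.exp (c ^ 2 * t ^ 2 / 2)
            ∂(Measure.pi fun _ : Fin n => P) := by
          refine integral_mono_of_nonneg (.of_forall fun zr => ?_) ?_ ?_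
          · exact mul_nonneg (Real.exp_pos _).le (integral_nonneg fun _ => (Real.exp_pos _).le)
          · refine Integrable.mul_const ?_ _
            refine integrable_of_measurable_of_abs_le (b := Real.exp (|t| * (b + b)))
              (by fun_prop) ?_
            intro q
            exact hexp _ _ ((abs_sub _ _).trans (add_le_add (hf₁b _) hμ₁b))
          · filter_upwards [hinner] with zr hzr
            gcongr
      _ ≤ Real.exp (n * c ^ 2 * t ^ 2 / 2) * Real.exp (c ^ 2 * t ^ 2 / 2) := by
          rw [integral_mul_const]
          gcongr
          exact ih f₁ hf₁m hf₁b hd₁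
      _ = _ := by
          rw [← Real.exp_add]
          push_cast
          ring_nf

/-- McDiarmid's inequality, with differences that are bounded almost everywhere. -/
theorem measureReal_ge_le_of_bounded_differences {Z : Type*} [MeasurableSpace Z] (P : Measure Z)
    [IsProbabilityMeasure P] {c b : ℝ} {n : ℕ} {f : (Fin n → Z) → ℝ} (hf : Measurable f)
    (hb : ∀ z, |f z| ≤ b)
    (hd : ∀ i, ∀ᵐ q ∂(Measure.pi fun _ : Fin n => P).prod P,
      f q.1 ≤ f (Function.update q.1 i q.2) + c) {s : ℝ} (hs : 0 ≤ s) :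
    (Measure.pi fun _ : Fin n => P).real
      {z | s ≤ f z - ∫ y, f y ∂Measure.pi fun _ : Fin n => P} ≤
      Real.exp (-s ^ 2 / (2 * (n * c ^ 2))) := by
  have h : ProbabilityTheory.HasSubgaussianMGF
      (fun z => f z - ∫ y, f y ∂Measure.pi fun _ : Fin n => P)
      ⟨n * c ^ 2, by positivity⟩ (Measure.pi fun _ : Fin n => P) := by
    refine ⟨fun t => ?_, fun t => ?_⟩
    · refine ProbabilityTheory.integrable_exp_mul_of_mem_Icc
        (a := -b - ∫ y, f y ∂Measure.pi fun _ : Fin n => P)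
        (b := b - ∫ y, f y ∂Measure.pi fun _ : Fin n => P) (by fun_prop) (.of_forall fun z => ?_)
      have := abs_le.1 (hb z)
      constructor <;> linarith [this.1, this.2]
    · exact integral_exp_le_of_bounded_differences P c b t n f hf hb hd
  exact h.measure_ge_le hs

/-! ### Measurable majorants and outer expectation. -/

/-- A bounded function has a least measurable majorant up to null sets, and the integral of that
majorant is at most the upper expectation. -/
theorem exists_measurable_cover {Ω : Type*} [MeasurableSpace Ω] (μ : Measure Ω)
    [IsProbabilityMeasure μ] {f : Ω → ℝ} {b : ℝ} (hf : ∀ ω, |f ω| ≤ b) :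
    ∃ g : Ω → ℝ, Measurable g ∧ (∀ ω, |g ω| ≤ b) ∧ (∀ ω, f ω ≤ g ω) ∧
      ∫ ω, g ω ∂μ ≤ upperExpectation μ f ∧
      ∀ g' : Ω → ℝ, Measurable g' → (∀ ω, f ω ≤ g' ω) → ∀ᵐ ω ∂μ, g ω ≤ g' ω := by
  set S := {r : ℝ | ∃ g : Ω → ℝ, Integrable g μ ∧ (∀ ω, f ω ≤ g ω) ∧ ∫ ω, g ω ∂μ = r} with hS
  have hne : S.Nonempty :=
    ⟨_, fun _ => b, integrable_const _, fun ω => (le_abs_self _).trans (hf ω), rfl⟩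
  have hbd : BddBelow S := by
    refine ⟨-b, ?_⟩
    rintro r ⟨g, hg, hfg, rfl⟩
    have := integral_mono (integrable_const (-b)) hg fun ω => (neg_le_of_abs_le (hf ω)).trans (hfg ω)
    simpa using this
  -- every integrable majorant dominates, a.e., a bounded measurable one
  have key : ∀ g : Ω → ℝ, Integrable g μ → (∀ ω, f ω ≤ g ω) →
      ∃ g' : Ω → ℝ, Measurable g' ∧ (∀ ω, |g' ω| ≤ b) ∧ (∀ ω, f ω ≤ g' ω) ∧
        ∀ᵐ ω ∂μ, g' ω ≤ g ω := by
    intro g hg hfg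
    obtain ⟨g₀, hg₀m, hg₀⟩ := hg.aestronglyMeasurable.aemeasurable
    obtain ⟨N, hN, hNm, hN0⟩ := exists_measurable_superset_of_null (ae_iff.1 hg₀)
    classical
    have hgN : ∀ ω ∉ N, g ω = g₀ ω := fun ω hω => by
      by_contra h
      exact hω (hN h)
    -- The measurable version may fail to majorise f on a null set; the value b there restores the
    -- bound at every point.
    refine ⟨fun ω => if ω ∈ N then b else max (-b) (min b (g₀ ω)),
      Measurable.ite hNm measurable_const (by fun_prop), fun ω => ?_, fun ω => ?_, ?_⟩
    · have hb0 : 0 ≤ b := (abs_nonneg _).trans (hf ω)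
      dsimp only
      split_ifs
      · rw [abs_of_nonneg hb0]
      · rw [abs_le]
        exact ⟨le_max_left _ _, max_le (by linarith) (min_le_left _ _)⟩
    · have := abs_le.1 (hf ω)
      dsimp only
      split_ifs with h
      · exact this.2
      · exact le_max_of_le_right (le_min this.2 (hgN ω h ▸ hfg ω))
    · have : ∀ᵐ ω ∂μ, ω ∉ N := measure_eq_zero_iff_ae_notMem.1 hN0
      filter_upwards [this] with ω hω
      simp only [hω, if_false]
      rw [← hgN ω hω]
      exact max_le ((neg_le_of_abs_le (hf ω)).trans (hfg ω)) (min_le_right _ _)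
  have hseq : ∀ k : ℕ, ∃ g : Ω → ℝ, Measurable g ∧ (∀ ω, |g ω| ≤ b) ∧ (∀ ω, f ω ≤ g ω) ∧
      ∫ ω, g ω ∂μ ≤ upperExpectation μ f + 1 / ((k : ℝ) + 1) := by
    intro k
    obtain ⟨r, ⟨g, hg, hfg, rfl⟩, hr⟩ := exists_lt_of_csInf_lt hne
      (lt_add_of_pos_right (sInf S) (Nat.one_div_pos_of_nat (α := ℝ) (n := k)))
    obtain ⟨g', hg'm, hg'b, hfg', hg'⟩ := key g hg hfg
    exact ⟨g', hg'm, hg'b, hfg',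
      (integral_mono_ae (integrable_of_measurable_of_abs_le hg'm hg'b) hg hg').trans hr.le⟩
  choose G hGm hGb hfG hGi using hseq
  have hBB : ∀ ω, BddBelow (Set.range fun k => G k ω) := fun ω =>
    ⟨f ω, by rintro _ ⟨k, rfl⟩; exact hfG k ω⟩
  set T : Ω → ℝ := fun ω => ⨅ k, G k ω with hT
  have hTm : Measurable T := Measurable.iInf hGm
  have hTf : ∀ ω, f ω ≤ T ω := fun ω => le_ciInf fun k => hfG k ω
  have hTb : ∀ ω, |T ω| ≤ b := fun ω => abs_le.2
    ⟨(neg_le_of_abs_le (hf ω)).trans (hTf ω),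
      (ciInf_le (hBB ω) 0).trans ((le_abs_self _).trans (hGb 0 ω))⟩
  have hTi := integrable_of_measurable_of_abs_le (μ := μ) hTm hTb
  have hTint : ∫ ω, T ω ∂μ ≤ upperExpectation μ f := by
    have h1 : ∀ k : ℕ, ∫ ω, T ω ∂μ ≤ upperExpectation μ f + 1 / ((k : ℝ) + 1) := fun k =>
      (integral_mono hTi (integrable_of_measurable_of_abs_le (hGm k) (hGb k))
        fun ω => ciInf_le (hBB ω) k).trans (hGi k)
    have h2 := (tendsto_one_div_add_atTop_nhds_zero_nat (𝕜 := ℝ)).const_add (upperExpectation μ f)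
    rw [add_zero] at h2
    exact ge_of_tendsto' h2 h1
  refine ⟨T, hTm, hTb, hTf, hTint, fun g' hg'm hfg' => ?_⟩
  have hmin : ∀ ω, |min (T ω) (g' ω)| ≤ b := fun ω => abs_le.2
    ⟨(neg_le_of_abs_le (hf ω)).trans (le_min (hTf ω) (hfg' ω)),
      (min_le_left _ _).trans ((le_abs_self _).trans (hTb ω))⟩
  have hmini : Integrable (fun ω => min (T ω) (g' ω)) μ :=
    integrable_of_measurable_of_abs_le (hTm.min hg'm) hmin
  -- Minimality: the minimum of T and g' is again a majorant, so its integral cannot be below that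
  -- of T, and the two agree almost everywhere.
  have hle : upperExpectation μ f ≤ ∫ ω, min (T ω) (g' ω) ∂μ :=
    csInf_le hbd ⟨_, hmini, fun ω => le_min (hTf ω) (hfg' ω), rfl⟩
  have hsub : ∫ ω, (T ω - min (T ω) (g' ω)) ∂μ = 0 := by
    refine le_antisymm ?_ (integral_nonneg fun ω => sub_nonneg.2 (min_le_left _ _))
    rw [integral_sub hTi hmini]
    linarith
  rw [integral_eq_zero_iff_of_nonneg (fun ω => sub_nonneg.2 (min_le_left _ _))
    (hTi.sub hmini)] at hsub
  filter_upwards [hsub] with ω hω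
  have : T ω = min (T ω) (g' ω) := sub_eq_zero.1 hω
  rw [this]
  exact min_le_right _ _

/-- The bound on f keeps the set of integrals bounded below; otherwise its real infimum would be the
default value 0. -/
theorem upperExpectation_le_integral {Ω : Type*} [MeasurableSpace Ω] (μ : Measure Ω)
    [IsProbabilityMeasure μ] {f g : Ω → ℝ} {b : ℝ} (hf : ∀ ω, |f ω| ≤ b) (hg : Integrable g μ)
    (hfg : ∀ ω, f ω ≤ g ω) : upperExpectation μ f ≤ ∫ ω, g ω ∂μ := by
  refine csInf_le ⟨-b, ?_⟩ ⟨g, hg, hfg, rfl⟩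
  rintro r ⟨g, hg, hfg, rfl⟩
  have := integral_mono (integrable_const (-b)) hg fun ω => (neg_le_of_abs_le (hf ω)).trans (hfg ω)
  simpa using this

/-- McDiarmid's inequality for a function that need not be measurable: up to a measurable event of
small probability it exceeds its upper expectation by at most `s`. -/
theorem exists_measurableSet_le_upperExpectation_add {Z : Type*} [MeasurableSpace Z]
    (P : Measure Z) [IsProbabilityMeasure P] {c b : ℝ} {n : ℕ} {f : (Fin n → Z) → ℝ}
    (hb : ∀ z, |f z| ≤ b) (hd : ∀ i z w, f z ≤ f (Function.update z i w) + c)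
    {s : ℝ} (hs : 0 ≤ s) :
    ∃ G : Set (Fin n → Z), MeasurableSet G ∧
      1 - Real.exp (-s ^ 2 / (2 * (n * c ^ 2))) ≤ (Measure.pi fun _ : Fin n => P).real G ∧
      ∀ z ∈ G, f z ≤ upperExpectation (Measure.pi fun _ : Fin n => P) f + s := by
  obtain ⟨g, hgm, hgb, hfg, hgi, hmin⟩ :=
    exists_measurable_cover (Measure.pi fun _ : Fin n => P) hb
  have hupd : ∀ i, Measurable fun q : (Fin n → Z) × Z => Function.update q.1 i q.2 := by
    intro i
    refine measurable_pi_lambda _ fun j => ?_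
    by_cases h : j = i
    · subst h
      simpa using measurable_snd
    · simp only [Function.update_of_ne h]
      fun_prop
  have h1 : ∀ i, ∀ᵐ q ∂(Measure.pi fun _ : Fin n => P).prod P,
      g q.1 ≤ g (Function.update q.1 i q.2) + c := by
    intro i
    have hm := hupd i
    have hset : MeasurableSet {q : Z × (Fin n → Z) | g q.2 ≤ g (Function.update q.2 i q.1) + c} :=
      measurableSet_le (hgm.comp measurable_snd) ((hgm.comp (hm.comp measurable_swap)).add_const c)
    have h : ∀ᵐ q ∂P.prod (Measure.pi fun _ : Fin n => P),
        g q.2 ≤ g (Function.update q.2 i q.1) + c := by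
      rw [Measure.ae_prod_iff_ae_ae hset]
      -- For fixed w the right side is a measurable majorant of f, so the least majorant lies below
      -- it for almost every z. The exceptional set depends on w, so only an almost everywhere
      -- statement on pairs survives.
      refine .of_forall fun w => hmin _ ?_ fun z => ?_
      · exact (hgm.comp (hm.comp (measurable_id.prodMk measurable_const))).add_const c
      · exact (hd i z w).trans (add_le_add_left (hfg _) c)
    exact (Measure.measurePreserving_swap (μ := Measure.pi fun _ : Fin n => P)
      (ν := P)).quasiMeasurePreserving.ae h
  refine ⟨{z | g z - ∫ y, g y ∂(Measure.pi fun _ : Fin n => P) < s},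
    measurableSet_lt (hgm.sub_const _) measurable_const, ?_, fun z hz => ?_⟩
  · have h := measureReal_ge_le_of_bounded_differences P hgm hgb h1 hs
    have hm : MeasurableSet {z | g z - ∫ y, g y ∂(Measure.pi fun _ : Fin n => P) < s} :=
      measurableSet_lt (hgm.sub_const _) measurable_const
    have h' := probReal_compl_eq_one_sub (μ := Measure.pi fun _ : Fin n => P) hm
    simp only [Set.compl_ofPred, not_lt] at h'
    linarith
  · have : g z - ∫ y, g y ∂(Measure.pi fun _ : Fin n => P) < s := hz
    linarith [hfg z]

/-! ### Random signs with prescribed means, and contraction. -/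

theorem sum_intUnits (f : ℤˣ → ℝ) : ∑ s, f s = f 1 + f (-1) := by
  rw [UnitsInt.univ, Finset.sum_pair (by decide)]

/-- The probability of the sign vector `s` when the signs are independent with means `d i`. -/
noncomputable def signWeight {n : ℕ} (d : Fin n → ℝ) (s : Fin n → ℤˣ) : ℝ :=
  ∏ i, (1 + ((s i : ℤ) : ℝ) * d i) / 2

theorem signWeight_nonneg {n : ℕ} {d : Fin n → ℝ} (hd : ∀ i, |d i| ≤ 1) (s : Fin n → ℤˣ) :
    0 ≤ signWeight d s := by
  refine Finset.prod_nonneg fun i _ => ?_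
  have := abs_le.1 (hd i)
  rcases Int.units_eq_one_or (s i) with h | h <;> rw [h] <;> push_cast <;> linarith [this.1, this.2]

theorem sum_signWeight {n : ℕ} (d : Fin n → ℝ) : ∑ s, signWeight d s = 1 := by
  have h := Fintype.prod_sum fun (i : Fin n) (s : ℤˣ) => (1 + ((s : ℤ) : ℝ) * d i) / 2
  unfold signWeight
  rw [← h]
  refine Finset.prod_eq_one fun i _ => ?_
  rw [sum_intUnits]
  push_cast
  ring

/-- The sum factorises over coordinates: every factor except the k-th is 1, and the k-th is the mean
of its sign. Thus any number in [-1, 1] is an average of signs. -/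
theorem sum_signWeight_mul {n : ℕ} (d : Fin n → ℝ) (k : Fin n) :
    ∑ s, signWeight d s * ((s k : ℤ) : ℝ) = d k := by
  have h := Fintype.prod_sum fun (i : Fin n) (s : ℤˣ) =>
    (1 + ((s : ℤ) : ℝ) * d i) / 2 * (if i = k then ((s : ℤ) : ℝ) else 1)
  have h2 : ∀ s : Fin n → ℤˣ, signWeight d s * ((s k : ℤ) : ℝ) =
      ∏ i, ((1 + ((s i : ℤ) : ℝ) * d i) / 2 * (if i = k then ((s i : ℤ) : ℝ) else 1)) := by
    intro s
    rw [Finset.prod_mul_distrib, Finset.prod_ite_eq' Finset.univ k fun i => ((s i : ℤ) : ℝ)]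
    simp [signWeight]
  simp_rw [h2]
  rw [← h, Finset.prod_eq_single k]
  · rw [sum_intUnits]
    simp
    ring
  · intro i _ hi
    rw [sum_intUnits]
    simp [hi]
    ring
  · simp

theorem measurable_signWeight {Z : Type*} [MeasurableSpace Z] {n : ℕ} {d : Z → ℝ}
    (hd : Measurable d) (s : Fin n → ℤˣ) :
    Measurable fun z : Fin n → Z => signWeight (fun i => d (z i)) s := by
  unfold signWeight
  fun_prop

/-- Contraction: majorants `g σ` of the signed sums `∑ i, σ i * u h (z i)` give majorants of the
weighted sums `∑ i, σ i * d (z i) * u h (z i)` with the same total mean. -/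
theorem exists_majorants_of_weights {Z ι : Type*} [MeasurableSpace Z] {n : ℕ}
    (Q : Measure (Fin n → Z)) [IsProbabilityMeasure Q] {u : ι → Z → ℝ} {d : Z → ℝ}
    (hd : Measurable d) (hd1 : ∀ z, |d z| ≤ 1) {g : (Fin n → ℤˣ) → (Fin n → Z) → ℝ} {b : ℝ}
    (hg : ∀ σ, Measurable (g σ)) (hgb : ∀ σ z, |g σ z| ≤ b)
    (hug : ∀ h σ z, ∑ i, ((σ i : ℤ) : ℝ) * u h (z i) ≤ g σ z) :
    ∃ M : (Fin n → ℤˣ) → (Fin n → Z) → ℝ, (∀ σ, Measurable (M σ)) ∧ (∀ σ z, |M σ z| ≤ b) ∧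
      (∀ h σ z, ∑ i, ((σ i : ℤ) : ℝ) * (d (z i) * u h (z i)) ≤ M σ z) ∧
      ∑ σ, ∫ z, M σ z ∂Q = ∑ σ, ∫ z, g σ z ∂Q := by
  have hM : ∀ σ s, Measurable fun z : Fin n → Z => signWeight (fun i => d (z i)) s * g (σ * s) z :=
    fun σ s => (measurable_signWeight hd s).mul (hg _)
  have hw : ∀ (z : Fin n → Z) s, 0 ≤ signWeight (fun i => d (z i)) s :=
    fun z s => signWeight_nonneg (fun i => hd1 _) s
  have hw1 : ∀ (z : Fin n → Z) s, signWeight (fun i => d (z i)) s ≤ 1 := fun z s => by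
    rw [← sum_signWeight fun i => d (z i)]
    exact Finset.single_le_sum (fun s _ => hw z s) (Finset.mem_univ s)
  -- Replacing d (z i) by the mean of a random sign s i turns a weighted sum into an average of
  -- signed sums with signs σ * s. For fixed s the map σ ↦ σ * s is a bijection, so summing over σ
  -- leaves the total mean unchanged.
  refine ⟨fun σ z => ∑ s, signWeight (fun i => d (z i)) s * g (σ * s) z,
    fun σ => Finset.measurable_sum _ fun s _ => hM σ s, fun σ z => ?_, fun h σ z => ?_, ?_⟩
  · calc _ ≤ ∑ s, |signWeight (fun i => d (z i)) s * g (σ * s) z| :=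
          Finset.abs_sum_le_sum_abs _ _
      _ ≤ ∑ s, signWeight (fun i => d (z i)) s * b := by
          refine Finset.sum_le_sum fun s _ => ?_
          rw [abs_mul, abs_of_nonneg (hw z s)]
          exact mul_le_mul_of_nonneg_left (hgb _ _) (hw z s)
      _ = b := by rw [← Finset.sum_mul, sum_signWeight, one_mul]
  · calc _ = ∑ s, signWeight (fun i => d (z i)) s *
            ∑ i, (((σ * s) i : ℤ) : ℝ) * u h (z i) := by
          simp_rw [Finset.mul_sum]
          rw [Finset.sum_comm]
          refine Finset.sum_congr rfl fun k _ => ?_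
          rw [← sum_signWeight_mul (fun i => d (z i)) k, Finset.sum_mul, Finset.mul_sum]
          refine Finset.sum_congr rfl fun s _ => ?_
          simp only [Pi.mul_apply, Units.val_mul]
          push_cast
          ring
      _ ≤ _ := Finset.sum_le_sum fun s _ => mul_le_mul_of_nonneg_left (hug h _ z) (hw z s)
  · have hi : ∀ σ s, Integrable
        (fun z : Fin n → Z => signWeight (fun i => d (z i)) s * g (σ * s) z) Q := fun σ s =>
      integrable_of_measurable_of_abs_le (b := b) (hM σ s) fun z => by
        rw [abs_mul, abs_of_nonneg (hw z s)]
        exact (mul_le_of_le_one_left (abs_nonneg _) (hw1 z s)).trans (hgb _ _)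
    have hi' : ∀ τ s, Integrable
        (fun z : Fin n → Z => signWeight (fun i => d (z i)) s * g τ z) Q := fun τ s => by
      simpa using hi (τ * s⁻¹) s
    calc ∑ σ, ∫ z, ∑ s, signWeight (fun i => d (z i)) s * g (σ * s) z ∂Q
        = ∑ σ, ∑ s, ∫ z, signWeight (fun i => d (z i)) s * g (σ * s) z ∂Q :=
          Finset.sum_congr rfl fun σ _ => integral_finsetSum _ fun s _ => hi σ s
      _ = ∑ s, ∑ σ, ∫ z, signWeight (fun i => d (z i)) s * g (σ * s) z ∂Q := Finset.sum_comm
      _ = ∑ s, ∑ τ, ∫ z, signWeight (fun i => d (z i)) s * g τ z ∂Q :=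
          Finset.sum_congr rfl fun s _ => Fintype.sum_equiv (Equiv.mulRight s) _ _ fun σ => rfl
      _ = ∑ τ, ∑ s, ∫ z, signWeight (fun i => d (z i)) s * g τ z ∂Q := Finset.sum_comm
      _ = ∑ τ, ∫ z, g τ z ∂Q := by
          refine Finset.sum_congr rfl fun τ _ => ?_
          rw [← integral_finsetSum _ fun s _ => hi' τ s]
          simp_rw [← Finset.sum_mul, sum_signWeight, one_mul]

/-! ### Symmetrization with a ghost sample. -/

/-- The sample that takes the `i`-th point from `z` if `σ i = 1` and from `z'` otherwise. -/
def mixSample {Z : Type*} {n : ℕ} (σ : Fin n → ℤˣ) (q : (Fin n → Z) × (Fin n → Z)) : Fin n → Z :=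
  fun i => if σ i = 1 then q.1 i else q.2 i

/-- The preimage of a box is a product of two boxes, and each coordinate is constrained in exactly
one of them. -/
theorem measurePreserving_mixSample {Z : Type*} [MeasurableSpace Z] (P : Measure Z)
    [IsProbabilityMeasure P] {n : ℕ} (σ : Fin n → ℤˣ) :
    MeasurePreserving (mixSample σ)
      ((Measure.pi fun _ : Fin n => P).prod (Measure.pi fun _ : Fin n => P))
      (Measure.pi fun _ : Fin n => P) := by
  have hm : Measurable (mixSample (Z := Z) σ) := by
    refine measurable_pi_lambda _ fun i => ?_
    unfold mixSample
    split_ifs <;> fun_prop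
  refine ⟨hm, (Measure.pi_eq fun s hs => ?_).symm⟩
  rw [Measure.map_apply hm (MeasurableSet.univ_pi hs)]
  have : mixSample σ ⁻¹' Set.univ.pi s =
      (Set.univ.pi fun i => if σ i = 1 then s i else Set.univ) ×ˢ
        (Set.univ.pi fun i => if σ i = 1 then Set.univ else s i) := by
    ext q
    simp only [Set.mem_preimage, Set.mem_pi, Set.mem_univ, true_imp_iff, Set.mem_prod, mixSample,
      ← forall_and]
    refine forall_congr' fun i => ?_
    split_ifs <;> simp
  rw [this, Measure.prod_prod, Measure.pi_pi, Measure.pi_pi, ← Finset.prod_mul_distrib]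
  refine Finset.prod_congr rfl fun i _ => ?_
  split_ifs <;> simp

theorem integrable_eval_pi {Z : Type*} [MeasurableSpace Z] {n : ℕ} (P : Measure Z)
    [IsProbabilityMeasure P] {f : Z → ℝ} (hf : Integrable f P) (i : Fin n) :
    Integrable (fun z : Fin n → Z => f (z i)) (Measure.pi fun _ : Fin n => P) :=
  (measurePreserving_eval (fun _ : Fin n => P) i).integrable_comp_of_integrable hf

theorem integral_eval_pi {Z : Type*} [MeasurableSpace Z] {n : ℕ} (P : Measure Z)
    [IsProbabilityMeasure P] {f : Z → ℝ} (hf : Integrable f P) (i : Fin n) :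
    ∫ z, f (z i) ∂(Measure.pi fun _ : Fin n => P) = ∫ y, f y ∂P := by
  have he := measurePreserving_eval (fun _ : Fin n => P) i
  have hfm : AEStronglyMeasurable f (Measure.map (Function.eval i) (Measure.pi fun _ => P)) := by
    rw [he.map_eq]
    exact hf.aestronglyMeasurable
  conv_rhs => rw [← he.map_eq, integral_map he.measurable.aemeasurable hfm]

/-- Symmetrization: majorants `M σ` of the signed sums `∑ i, σ i * v h (z i)` give a majorant of
the centred sums `∑ i, (v h (z i) - E (v h))`, uniformly in `h`. -/
theorem exists_majorant_centred_sum {Z ι : Type*} [MeasurableSpace Z] {n : ℕ} (P : Measure Z)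
    [IsProbabilityMeasure P] {v : ι → Z → ℝ} (hv : ∀ h, Integrable (v h) P)
    {M : (Fin n → ℤˣ) → (Fin n → Z) → ℝ} {b : ℝ} (hM : ∀ σ, Measurable (M σ))
    (hMb : ∀ σ z, |M σ z| ≤ b)
    (hvM : ∀ h σ z, ∑ i, ((σ i : ℤ) : ℝ) * v h (z i) ≤ M σ z) :
    ∃ U : (Fin n → Z) → ℝ, Measurable U ∧ (∀ z, |U z| ≤ 2 * b) ∧
      (∀ h z, ∑ i, (v h (z i) - ∫ y, v h y ∂P) ≤ U z) ∧
      ∫ z, U z ∂(Measure.pi fun _ : Fin n => P) =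
        2 * (1 / (2 : ℝ) ^ n * ∑ σ, ∫ z, M σ z ∂(Measure.pi fun _ : Fin n => P)) := by
  set Q := Measure.pi fun _ : Fin n => P with hQ
  -- For every σ, the sum of v(z i) - v(z' i) is the σ-signed sum over one mixed sample plus the
  -- (-σ)-signed sum over the complementary one. Both mixed samples are i.i.d., whence the factor 2
  -- in the mean; integrating out z' then gives U.
  set W : (Fin n → Z) × (Fin n → Z) → ℝ := fun q =>
    1 / (2 : ℝ) ^ n * ∑ σ, (M σ (mixSample σ q) + M (-σ) (mixSample (-σ) q)) with hW
  have hmix := fun σ : Fin n → ℤˣ => measurePreserving_mixSample (Z := Z) P σ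
  have hMm : ∀ σ, Measurable fun q : (Fin n → Z) × (Fin n → Z) => M σ (mixSample σ q) := fun σ =>
    (hM σ).comp (hmix σ).measurable
  have hWm : Measurable W :=
    (Finset.measurable_sum _ fun σ _ => (hMm σ).add (hMm (-σ))).const_mul _
  have hcard : (Finset.univ : Finset (Fin n → ℤˣ)).card = 2 ^ n := by
    simp [Finset.card_univ]
  have hWb : ∀ q, |W q| ≤ 2 * b := by
    intro q
    have h1 : |∑ σ, (M σ (mixSample σ q) + M (-σ) (mixSample (-σ) q))| ≤ 2 ^ n * (2 * b) := by
      refine (Finset.abs_sum_le_sum_abs _ _).trans ?_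
      refine (Finset.sum_le_card_nsmul _ _ (2 * b) fun σ _ => ?_).trans ?_
      · refine (abs_add_le _ _).trans ?_
        linarith [hMb σ (mixSample σ q), hMb (-σ) (mixSample (-σ) q)]
      · rw [hcard]
        simp
    rw [hW, abs_mul, abs_of_pos (by positivity)]
    calc _ ≤ 1 / (2 : ℝ) ^ n * (2 ^ n * (2 * b)) := by gcongr
      _ = _ := by field_simp
  have hdom : ∀ h q, ∑ i, (v h (q.1 i) - v h (q.2 i)) ≤ W q := by
    intro h q
    have h1 : ∀ σ : Fin n → ℤˣ, ∑ i, (v h (q.1 i) - v h (q.2 i)) ≤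
        M σ (mixSample σ q) + M (-σ) (mixSample (-σ) q) := by
      intro σ
      refine le_trans (le_of_eq ?_) (add_le_add (hvM h σ _) (hvM h (-σ) _))
      rw [← Finset.sum_add_distrib]
      refine Finset.sum_congr rfl fun i _ => ?_
      simp only [mixSample, Pi.neg_apply]
      rcases Int.units_eq_one_or (σ i) with hσ | hσ <;> simp [hσ] <;> ring
    calc _ = 1 / (2 : ℝ) ^ n * ∑ _σ : Fin n → ℤˣ, ∑ i, (v h (q.1 i) - v h (q.2 i)) := by
          rw [Finset.sum_const, hcard, nsmul_eq_mul]
          push_cast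
          field_simp
      _ ≤ _ := by
          exact mul_le_mul_of_nonneg_left (Finset.sum_le_sum fun σ _ => h1 σ) (by positivity)
  have hWi : ∀ z, Integrable (fun z' => W (z, z')) Q := fun z =>
    integrable_of_measurable_of_abs_le (hWm.comp measurable_prodMk_left) fun _ => hWb _
  refine ⟨fun z => ∫ z', W (z, z') ∂Q, ?_, fun z => ?_, fun h z => ?_, ?_⟩
  · exact hWm.stronglyMeasurable.integral_prod_right.measurable
  · simpa using norm_integral_le_of_norm_le_const (μ := Q) (f := fun z' => W (z, z'))
      (.of_forall fun z' => hWb _)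
  · have hev := fun i => integrable_eval_pi P (n := n) (hv h) i
    have hevi := fun i => integral_eval_pi P (n := n) (hv h) i
    have hsum : ∑ i, (v h (z i) - ∫ y, v h y ∂P) =
        ∫ z' : Fin n → Z, ∑ i, (v h (z i) - v h (z' i)) ∂Q := by
      rw [integral_finsetSum (f := fun i (z' : Fin n → Z) => v h (z i) - v h (z' i)) _
        fun i _ => (integrable_const _).sub (hev i)]
      refine Finset.sum_congr rfl fun i _ => ?_
      rw [integral_sub (integrable_const _) (hev i), hevi]
      simp
    rw [hsum]
    exact integral_mono (integrable_finsetSum _ fun i _ => (integrable_const _).sub (hev i))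
      (hWi z) fun z' => hdom h (z, z')
  · have hMi : ∀ σ, Integrable (fun q => M σ (mixSample σ q)) (Q.prod Q) := fun σ =>
      integrable_of_measurable_of_abs_le (hMm σ) fun _ => hMb _ _
    have hMint : ∀ σ, ∫ q, M σ (mixSample σ q) ∂(Q.prod Q) = ∫ z, M σ z ∂Q := fun σ => by
      conv_rhs => rw [hQ, ← (hmix σ).map_eq,
        integral_map (hmix σ).measurable.aemeasurable (hM σ).aestronglyMeasurable]
    rw [← integral_prod W (integrable_of_measurable_of_abs_le hWm hWb), hW, integral_const_mul,
      integral_finsetSum (f := fun σ q => M σ (mixSample σ q) + M (-σ) (mixSample (-σ) q)) _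
        fun σ _ => (hMi σ).add (hMi (-σ))]
    have : ∀ σ : Fin n → ℤˣ, ∫ q, (M σ (mixSample σ q) + M (-σ) (mixSample (-σ) q)) ∂(Q.prod Q) =
        ∫ z, M σ z ∂Q + ∫ z, M (-σ) z ∂Q := fun σ => by
      rw [integral_add (hMi σ) (hMi (-σ)), hMint, hMint]
    simp_rw [this]
    rw [Finset.sum_add_distrib,
      Fintype.sum_equiv (Equiv.neg (Fin n → ℤˣ)) (fun σ => ∫ z, M (-σ) z ∂Q)
        (fun σ => ∫ z, M σ z ∂Q) fun σ => rfl]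
    ring

/-! ### Uniform deviations from Rademacher complexity. -/

theorem bddAbove_range_of_abs_le {ι : Type*} {f : ι → ℝ} {b : ℝ} (hf : ∀ i, |f i| ≤ b) :
    BddAbove (Set.range f) :=
  ⟨b, by rintro _ ⟨i, rfl⟩; exact (le_abs_self _).trans (hf i)⟩

theorem abs_ciSup_le_of_abs_le {ι : Type*} [Nonempty ι] {f : ι → ℝ} {b : ℝ}
    (hf : ∀ i, |f i| ≤ b) : |⨆ i, f i| ≤ b := by
  obtain ⟨i⟩ := ‹Nonempty ι›
  exact abs_le.2 ⟨(neg_le_of_abs_le (hf i)).trans (le_ciSup (bddAbove_range_of_abs_le hf) i),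
    ciSup_le fun i => (le_abs_self _).trans (hf i)⟩

theorem abs_val_le_one (b : Bool) : |val b| ≤ 1 := by
  cases b <;> simp [val]

theorem measurable_apply_prediction {Z : Type*} [MeasurableSpace Z] {φ : Z → Bool → ℝ}
    (hφ : ∀ y, Measurable fun z => φ z y) {k : Z → Bool} (hk : Measurable k) :
    Measurable fun z => φ z (k z) := by
  have h : ∀ z, φ z (k z) = if k z = true then φ z true else φ z false := fun z => by
    cases k z <;> simp
  simp_rw [h]
  exact Measurable.ite (hk (measurableSet_singleton true)) (hφ _) (hφ _)

/-- Majorants of the signed sums of a class of classifiers whose means are controlled by the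
Rademacher complexity. -/
theorem exists_majorants_rademacher {X Z : Type*} [MeasurableSpace X] [MeasurableSpace Z]
    (P : Measure Z) [IsProbabilityMeasure P] {π : Z → X} (hπ : Measurable π)
    {H : Set (X → Bool)} (hne : H.Nonempty) {n : ℕ} (hn : 1 ≤ n) :
    ∃ g : (Fin n → ℤˣ) → (Fin n → Z) → ℝ, (∀ σ, Measurable (g σ)) ∧ (∀ σ z, |g σ z| ≤ n) ∧
      (∀ (h : H) σ z, ∑ i, ((σ i : ℤ) : ℝ) * val (h.1 (π (z i))) ≤ g σ z) ∧
      1 / (2 : ℝ) ^ n * ∑ σ, ∫ z, g σ z ∂(Measure.pi fun _ : Fin n => P) ≤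
        n * rademacherComplexity (P.map π) H n := by
  have hn0 : (0 : ℝ) < n := by exact_mod_cast hn
  have := Measure.isProbabilityMeasure_map (μ := P) hπ.aemeasurable
  have : Nonempty H := hne.to_subtype
  set Q := Measure.pi fun _ : Fin n => P.map π with hQ
  have hb : ∀ (σ : Fin n → ℤˣ) (x : Fin n → X) (h : H),
      |(1 / (n : ℝ)) * ∑ i, ((σ i : ℤ) : ℝ) * val (h.1 (x i))| ≤ 1 := by
    intro σ x h
    rw [abs_mul, abs_of_pos (by positivity), one_div, inv_mul_le_iff₀ hn0, mul_one]
    refine (Finset.abs_sum_le_sum_abs _ _).trans ?_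
    refine (Finset.sum_le_card_nsmul _ _ 1 fun i _ => ?_).trans (by simp)
    rw [abs_mul]
    rcases Int.units_eq_one_or (σ i) with hσ | hσ <;> simpa [hσ] using abs_val_le_one _
  have hcov := fun σ : Fin n → ℤˣ => exists_measurable_cover Q fun x =>
    abs_ciSup_le_of_abs_le (hb σ x)
  choose g hgm hgb hfg hgi _ using hcov
  have hmp : MeasurePreserving (fun (z : Fin n → Z) i => π (z i))
      (Measure.pi fun _ : Fin n => P) Q :=
    measurePreserving_pi _ _ fun _ => ⟨hπ, rfl⟩
  refine ⟨fun σ z => n * g σ fun i => π (z i), fun σ => ((hgm σ).comp hmp.measurable).const_mul _,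
    fun σ z => ?_, fun h σ z => ?_, ?_⟩
  · rw [abs_mul, abs_of_pos hn0]
    exact mul_le_of_le_one_right hn0.le (hgb _ _)
  · have h1 := (le_ciSup (bddAbove_range_of_abs_le (hb σ fun i => π (z i))) h).trans
      (hfg σ fun i => π (z i))
    rw [one_div, inv_mul_le_iff₀ hn0] at h1
    exact h1
  · have hint : ∀ σ, ∫ z, n * g σ (fun i => π (z i)) ∂(Measure.pi fun _ : Fin n => P) =
        n * ∫ x, g σ x ∂Q := fun σ => by
      rw [integral_const_mul]
      congr 1
      conv_rhs => rw [← hmp.map_eq, integral_map hmp.measurable.aemeasurable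
        (hgm σ).aestronglyMeasurable]
    simp_rw [hint, ← Finset.mul_sum]
    rw [mul_left_comm]
    unfold rademacherComplexity
    gcongr with σ
    exact hgi σ

/-- Uniform one-sided deviation of empirical means over a class of binary classifiers, in terms of
its Rademacher complexity. -/
theorem exists_measurableSet_uniform_deviation {X Z : Type*} [MeasurableSpace X]
    [MeasurableSpace Z] (P : Measure Z) [IsProbabilityMeasure P] {π : Z → X} (hπ : Measurable π)
    {H : Set (X → Bool)} (hH : ∀ h ∈ H, Measurable h) {n : ℕ} (hn : 1 ≤ n)
    {φ : Z → Bool → ℝ} (hφ : ∀ y, Measurable fun z => φ z y) {b : ℝ} (hb0 : 0 < b)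
    (hb : ∀ z y, |φ z y| ≤ b) {η : ℝ} (hη0 : 0 < η) (hη1 : η ≤ 1) :
    ∃ G : Set (Fin n → Z), MeasurableSet G ∧ 1 - η ≤ (Measure.pi fun _ : Fin n => P).real G ∧
      ∀ D ∈ G, ∀ h ∈ H, (∑ i, φ (D i) (h (π (D i)))) / n - ∫ z, φ z (h (π z)) ∂P ≤
        4 * b * rademacherComplexity (P.map π) H n + 2 * b * √(2 * Real.log (1 / η) / n) := by
  have hn0 : (0 : ℝ) < n := by exact_mod_cast hn
  rcases H.eq_empty_or_nonempty with rfl | hne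
  · exact ⟨Set.univ, MeasurableSet.univ, by simp [hη0.le], by simp⟩
  have : Nonempty H := hne.to_subtype
  have hφm : ∀ h : H, Measurable fun z => φ z (h.1 (π z)) := fun h =>
    measurable_apply_prediction hφ ((hH h.1 h.2).comp hπ)
  have hφi : ∀ h : H, Integrable (fun z => φ z (h.1 (π z))) P := fun h =>
    integrable_of_measurable_of_abs_le (hφm h) fun _ => hb _ _
  have hφE : ∀ h : H, |∫ z, φ z (h.1 (π z)) ∂P| ≤ b := fun h => by
    simpa using norm_integral_le_of_norm_le_const (μ := P) (f := fun z => φ z (h.1 (π z)))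
      (.of_forall fun z => hb _ _)
  have hbF : ∀ (z : Fin n → Z) (h : H),
      |∑ i, (φ (z i) (h.1 (π (z i))) - ∫ y, φ y (h.1 (π y)) ∂P)| ≤ n * (2 * b) := by
    intro z h
    refine (Finset.abs_sum_le_sum_abs _ _).trans ?_
    refine (Finset.sum_le_card_nsmul _ _ (2 * b) fun i _ => ?_).trans (by simp)
    refine (abs_sub _ _).trans ?_
    linarith [hb (z i) (h.1 (π (z i))), hφE h]
  set T : (Fin n → Z) → ℝ := fun z =>
    ⨆ h : H, ∑ i, (φ (z i) (h.1 (π (z i))) - ∫ y, φ y (h.1 (π y)) ∂P) with hT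
  have hTb : ∀ z, |T z| ≤ n * (2 * b) := fun z => abs_ciSup_le_of_abs_le (hbF z)
  have hTd : ∀ i z w, T z ≤ T (Function.update z i w) + 2 * b := by
    intro i z w
    refine ciSup_le fun h => ?_
    refine le_trans ?_ (add_le_add_left
      (le_ciSup (bddAbove_range_of_abs_le (hbF (Function.update z i w))) h) _)
    rw [← sub_le_iff_le_add', ← Finset.sum_sub_distrib, Finset.sum_eq_single i]
    · simp only [Function.update_self]
      linarith [(abs_le.1 (hb (z i) (h.1 (π (z i))))).2, (abs_le.1 (hb w (h.1 (π w)))).1]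
    · intro j _ hj
      simp [Function.update_of_ne hj]
    · simp
  have hTE : upperExpectation (Measure.pi fun _ : Fin n => P) T ≤
      4 * b * (n * rademacherComplexity (P.map π) H n) := by
    obtain ⟨g, hgm, hgb, hug, hgi⟩ := exists_majorants_rademacher P hπ hne hn
    -- A function of z and a binary label y equals φ z false + (φ z true - φ z false) * val y.
    -- Dividing the coefficient by 2b puts it in [-1, 1]; this 2b and the 2 of symmetrization make
    -- up the constant 4b.
    obtain ⟨M, hMm, hMb, huM, hMi⟩ := exists_majorants_of_weights (Measure.pi fun _ : Fin n => P)
      (u := fun (h : H) z => val (h.1 (π z))) (d := fun z => (φ z true - φ z false) / (2 * b))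
      (((hφ _).sub (hφ _)).div_const _) (fun z => by
        rw [abs_div, abs_of_pos (by positivity : 0 < 2 * b), div_le_one (by positivity)]
        refine (abs_sub _ _).trans ?_
        linarith [hb z true, hb z false]) hgm hgb hug
    have hdec : ∀ (h : H) z, φ z (h.1 (π z)) - φ z false =
        (φ z true - φ z false) * val (h.1 (π z)) := fun h z => by
      cases h.1 (π z) <;> simp [val]
    have h0i : Integrable (fun z => φ z false) P :=
      integrable_of_measurable_of_abs_le (hφ _) fun _ => hb _ _
    obtain ⟨U, hUm, hUb, hvU, hUi⟩ := exists_majorant_centred_sum P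
      (v := fun (h : H) z => φ z (h.1 (π z)) - φ z false) (fun h => (hφi h).sub h0i)
      (M := fun σ z => 2 * b * M σ z) (b := 2 * b * n) (fun σ => (hMm σ).const_mul _)
      (fun σ z => by
        rw [abs_mul, abs_of_pos (by positivity : 0 < 2 * b)]
        exact mul_le_mul_of_nonneg_left (hMb σ z) (by positivity))
      (fun h σ z => by
        refine le_trans (le_of_eq ?_)
          (mul_le_mul_of_nonneg_left (huM h σ z) (by positivity : 0 ≤ 2 * b))
        rw [Finset.mul_sum]
        refine Finset.sum_congr rfl fun i _ => ?_
        rw [hdec]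
        field_simp)
    set c₀ := ∫ y, φ y false ∂P with hc₀
    -- The part φ z false does not depend on h, so its centred sum comes out of the supremum and has
    -- mean zero.
    have hsumi : Integrable (fun z : Fin n → Z => ∑ i, (φ (z i) false - c₀))
        (Measure.pi fun _ : Fin n => P) :=
      integrable_finsetSum _ fun i _ => (integrable_eval_pi P h0i i).sub (integrable_const _)
    have hsum0 : ∫ z : Fin n → Z, ∑ i, (φ (z i) false - c₀)
        ∂(Measure.pi fun _ : Fin n => P) = 0 := by
      rw [integral_finsetSum (f := fun i (z : Fin n → Z) => φ (z i) false - c₀) _ fun i _ =>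
        (integrable_eval_pi P h0i i).sub (integrable_const _)]
      refine Finset.sum_eq_zero fun i _ => ?_
      rw [integral_sub (integrable_eval_pi P h0i i) (integrable_const _), integral_eval_pi P h0i i]
      simp [hc₀]
    have hUint := integrable_of_measurable_of_abs_le (μ := Measure.pi fun _ : Fin n => P) hUm hUb
    refine (upperExpectation_le_integral _ hTb (hsumi.add hUint) fun z => ?_).trans ?_
    · refine ciSup_le fun h => ?_
      refine le_trans (le_of_eq ?_) (add_le_add_right (hvU h z) _)
      rw [← Finset.sum_add_distrib]
      refine Finset.sum_congr rfl fun i _ => ?_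
      rw [integral_sub (hφi h) h0i]
      ring
    · simp only [Pi.add_apply]
      rw [integral_add hsumi hUint, hsum0, hUi]
      simp_rw [integral_const_mul, ← Finset.mul_sum]
      rw [hMi]
      calc _ = 4 * b * (1 / (2 : ℝ) ^ n *
            ∑ σ, ∫ z, g σ z ∂(Measure.pi fun _ : Fin n => P)) := by ring
        _ ≤ _ := mul_le_mul_of_nonneg_left hgi (by positivity)
  have hlog : 0 ≤ Real.log (1 / η) := Real.log_nonneg ((one_le_div hη0).2 hη1)
  set r := √(2 * Real.log (1 / η) / n) with hr
  have hr2 : r ^ 2 = 2 * Real.log (1 / η) / n := Real.sq_sqrt (by positivity)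
  -- The sums are not normalised and have differences 2b; this s makes the McDiarmid exponent
  -- exactly log η.
  obtain ⟨G, hGm, hGp, hG⟩ := exists_measurableSet_le_upperExpectation_add P hTb hTd
    (s := n * (2 * b * r)) (by positivity)
  refine ⟨G, hGm, le_trans (le_of_eq ?_) hGp, fun D hD h hh => ?_⟩
  · congr 1
    have : -(n * (2 * b * r)) ^ 2 / (2 * (n * (2 * b) ^ 2)) = Real.log η := by
      rw [mul_pow, mul_pow _ r, hr2, one_div, Real.log_inv]
      field_simp
    rw [this, Real.exp_log hη0]
  · have h1 := (le_ciSup (bddAbove_range_of_abs_le (hbF D)) ⟨h, hh⟩).trans (hG D hD)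
    rw [Finset.sum_sub_distrib] at h1
    simp only [Finset.sum_const, Finset.card_univ, Fintype.card_fin, nsmul_eq_mul] at h1
    rw [div_sub' hn0.ne', div_le_iff₀ hn0]
    linarith

theorem one_sub_card_mul_le_measureReal_iInter {Ω κ : Type*} [MeasurableSpace Ω] [Fintype κ]
    (μ : Measure Ω) [IsProbabilityMeasure μ] {G : κ → Set Ω} (hG : ∀ k, MeasurableSet (G k))
    {ε : ℝ} (h : ∀ k, 1 - ε ≤ μ.real (G k)) :
    1 - Fintype.card κ * ε ≤ μ.real (⋂ k, G k) := by
  have h1 := probReal_compl_eq_one_sub (μ := μ) (MeasurableSet.iInter hG)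
  rw [Set.compl_iInter] at h1
  have h2 : μ.real (⋃ k, (G k)ᶜ) ≤ Fintype.card κ * ε := by
    refine (measureReal_iUnion_fintype_le _).trans ?_
    refine (Finset.sum_le_card_nsmul _ _ ε fun k _ => ?_).trans (by simp)
    rw [probReal_compl_eq_one_sub (hG k)]
    linarith [h k]
  linarith

/-- Uniform two-sided deviation of empirical means, simultaneously for finitely many functions of
the data point and the prediction. -/
theorem exists_measurableSet_uniform_abs_deviation {X Z κ : Type*} [MeasurableSpace X]
    [MeasurableSpace Z] [Fintype κ] [Nonempty κ] (P : Measure Z) [IsProbabilityMeasure P]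
    {π : Z → X} (hπ : Measurable π) {H : Set (X → Bool)} (hH : ∀ h ∈ H, Measurable h) {n : ℕ}
    (hn : 1 ≤ n) {φ : κ → Z → Bool → ℝ} (hφ : ∀ k y, Measurable fun z => φ k z y) {b : ℝ}
    (hb0 : 0 < b) (hb : ∀ k z y, |φ k z y| ≤ b) {η : ℝ} (hη0 : 0 < η) (hη1 : η ≤ 1) :
    ∃ G : Set (Fin n → Z), MeasurableSet G ∧ 1 - η ≤ (Measure.pi fun _ : Fin n => P).real G ∧
      ∀ D ∈ G, ∀ h ∈ H, ∀ k,
        |(∑ i, φ k (D i) (h (π (D i)))) / n - ∫ z, φ k z (h (π z)) ∂P| ≤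
          4 * b * rademacherComplexity (P.map π) H n +
            2 * b * √(2 * Real.log (2 * Fintype.card κ / η) / n) := by
  have hκ : (1 : ℝ) ≤ Fintype.card κ := by exact_mod_cast Fintype.card_pos (α := κ)
  have hη' : 0 < η / (2 * Fintype.card κ) := by positivity
  have hη'1 : η / (2 * Fintype.card κ) ≤ 1 := (div_le_one (by positivity)).2 (by linarith)
  -- Both signs of each statistic are used to get two-sided bounds, so the confidence is split over
  -- 2 |κ| events.
  have hex := fun q : κ × Bool => exists_measurableSet_uniform_deviation P hπ hH hn
    (φ := fun z y => (if q.2 then 1 else -1) * φ q.1 z y) (fun y => (hφ _ y).const_mul _) hb0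
    (fun z y => by cases q.2 <;> simpa using hb q.1 z y) hη' hη'1
  choose G hGm hGp hG using hex
  refine ⟨⋂ q, G q, MeasurableSet.iInter hGm, ?_, fun D hD h hh k => ?_⟩
  · refine le_trans (le_of_eq ?_) (one_sub_card_mul_le_measureReal_iInter _ hGm hGp)
    rw [Fintype.card_prod, Fintype.card_bool]
    push_cast
    field_simp
  · have h1 := hG (k, true) D (Set.mem_iInter.1 hD _) h hh
    have h2 := hG (k, false) D (Set.mem_iInter.1 hD _) h hh
    simp only [if_true, one_mul, Bool.false_eq_true, if_false, ← Finset.mul_sum,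
      integral_const_mul, one_div_div] at h1 h2
    rw [mul_div_assoc] at h2
    rw [abs_le]
    constructor <;> linarith

/-! ### From empirical means to conditional averages. -/

/-- Only the true denominator r is divided by: the difference is ((q' - q) + (q'/r')(r - r')) / r,
and |q'/r'| ≤ b holds even for r' = 0, the empty average. No lower bound on the empirical frequency
is needed. -/
theorem abs_div_sub_div_le {q q' r r' ε b p : ℝ} (hp : 0 < p) (hr : p ≤ r) (hq : |q' - q| ≤ ε)
    (hr' : |r' - r| ≤ ε) (hb0 : 0 ≤ b) (hr'0 : 0 ≤ r') (hb : |q'| ≤ b * r') :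
    |q' / r' - q / r| ≤ ε * (1 + b) / p := by
  have hr0 : 0 < r := hp.trans_le hr
  have hε : 0 ≤ ε := (abs_nonneg _).trans hq
  have hratio : |q' / r'| ≤ b := by
    rw [abs_div, abs_of_nonneg hr'0]
    exact div_le_of_le_mul₀ hr'0 hb0 hb
  have hmul : q' / r' * r' = q' := by
    rcases eq_or_ne r' 0 with h | h
    · rw [h, mul_zero, abs_nonpos_iff] at hb
      simp [hb]
    · exact div_mul_cancel₀ _ h
  have key : q' / r' - q / r = ((q' - q) + (q' / r') * (r - r')) / r := by
    rw [mul_sub, hmul]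
    field_simp
    ring
  rw [key, abs_div, abs_of_pos hr0]
  have hnum : |(q' - q) + (q' / r') * (r - r')| ≤ ε * (1 + b) := by
    refine (abs_add_le _ _).trans ?_
    rw [abs_mul, abs_sub_comm r r']
    nlinarith [mul_le_mul hratio hr' (abs_nonneg _) hb0]
  gcongr

variable {X A : Type*} [MeasurableSpace X] [MeasurableSpace A] {m : ℕ}

theorem measurableSet_correct {h : X → Bool} (hh : Measurable h) :
    MeasurableSet {z : X × A × Bool | h z.1 = z.2.2} := by
  have hm : Measurable fun z : X × A × Bool => (h z.1, z.2.2) := by fun_prop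
  exact hm (MeasurableSet.of_discrete (s := {q : Bool × Bool | q.1 = q.2}))

theorem acc_eq_integral (P : Measure (X × A × Bool)) {h : X → Bool} (hh : Measurable h) :
    acc P h = ∫ z, (if h z.1 = z.2.2 then (1 : ℝ) else 0) ∂P := by
  rw [acc, ← integral_indicator_one (measurableSet_correct hh)]
  refine integral_congr_ae (.of_forall fun z => ?_)
  simp [Set.indicator_apply]

theorem integral_cond_eq_div {Ω : Type*} [MeasurableSpace Ω] (P : Measure Ω) {s : Set Ω}
    (hs : MeasurableSet s) (f : Ω → ℝ) :
    ∫ z, f z ∂(ProbabilityTheory.cond P s) = (∫ z, s.indicator f z ∂P) / P.real s := by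
  rw [ProbabilityTheory.cond, integral_smul_measure, integral_indicator hs, ENNReal.toReal_inv,
    smul_eq_mul, div_eq_inv_mul, Measure.real]

open Classical in
/-- The empirical fairness violation is close to the true one if the empirical means of
`1_{E_j} g_j` and of `1_{E_j}` are close to the true ones. -/
theorem abs_empFair_sub_fair_le (P : Measure (X × A × Bool)) (F : FairnessMetric X A m)
    {b p ε : ℝ} (hb0 : 0 ≤ b) (hb : ∀ j z y, |F.g j z y| ≤ b) (hp : 0 < p)
    (hpe : ∀ j, p ≤ P.real (F.event j)) {n : ℕ} (hn : 1 ≤ n) (D : Fin n → X × A × Bool)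
    (h : X → Bool)
    (hq : ∀ j, |(∑ i, (F.event j).indicator (fun z => F.g j z (h z.1)) (D i)) / n -
      ∫ z, (F.event j).indicator (fun z => F.g j z (h z.1)) z ∂P| ≤ ε)
    (hr : ∀ j, |(∑ i, (F.event j).indicator (fun _ => (1 : ℝ)) (D i)) / n -
      P.real (F.event j)| ≤ ε) :
    |empFair F D h - fair P F h| ≤ m * (ε * (1 + b) / p) := by
  have hn0 : (0 : ℝ) < n := by exact_mod_cast hn
  unfold empFair fair
  refine (abs_abs_sub_abs_le _ _).trans ?_
  rw [← Finset.sum_sub_distrib]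
  refine (Finset.abs_sum_le_sum_abs _ _).trans ?_
  refine (Finset.sum_le_card_nsmul _ _ (ε * (1 + b) / p) fun j _ => ?_).trans (by simp)
  rw [integral_cond_eq_div P (F.measurableSet_event j)]
  have := abs_div_sub_div_le (q := ∫ z, (F.event j).indicator (fun z => F.g j z (h z.1)) z ∂P)
    hp (hpe j) (hq j) (hr j) hb0 (div_nonneg (Finset.sum_nonneg fun i _ =>
      Set.indicator_nonneg (fun _ _ => zero_le_one) _) hn0.le) (by
    rw [abs_div, abs_of_pos hn0, ← mul_div_assoc]
    gcongr
    rw [Finset.mul_sum]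
    refine (Finset.abs_sum_le_sum_abs _ _).trans (Finset.sum_le_sum fun i _ => ?_)
    by_cases hi : D i ∈ F.event j
    · simpa [hi] using hb j _ _
    · simp [hi])
  rw [div_div_div_cancel_right₀ hn0.ne'] at this
  exact this

theorem acc_mem_Icc (P : Measure (X × A × Bool)) [IsProbabilityMeasure P] (h : X → Bool) :
    acc P h ∈ Set.Icc (0 : ℝ) 1 :=
  ⟨measureReal_nonneg, measureReal_le_one⟩

theorem empAcc_le_one {X A : Type*} {n : ℕ} (D : Fin n → X × A × Bool) (h : X → Bool) : empAcc D h ≤ 1 := by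
  refine div_le_one_of_le₀ ?_ (Nat.cast_nonneg n)
  refine (Finset.sum_le_card_nsmul _ _ 1 fun i _ => ?_).trans (by simp)
  split_ifs <;> simp

/-! ### The deterministic trade-off argument. -/

/-- The suboptimality gap of an empirical minimiser when the empirical quantities are uniformly
close to the true ones. The hypothesis `hone` provides a near-optimal competitor at accuracy `1`,
where no classifier has a larger true accuracy than required. -/
theorem gap_le_of_uniform_close {P : Measure (X × A × Bool)} [IsProbabilityMeasure P]
    {F : FairnessMetric X A m} {H : Set (X → Bool)} {L : NNReal}
    (hfair : ∀ h ∈ H, fair P F h ≤ 1)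
    (hLip : LipschitzOnWith L (tradeoff P F H) (Set.Icc 0 1)) {n : ℕ}
    {D : Fin n → X × A × Bool} {α β θ δ : ℝ} (hθ : 0 ≤ θ)
    (hα : ∀ h ∈ H, |empAcc D h - acc P h| ≤ α) (hβ : ∀ h ∈ H, |empFair F D h - fair P F h| ≤ β)
    (hone : (∃ h ∈ H, 1 ≤ acc P h) →
      ∃ h ∈ H, fair P F h ≤ tradeoff P F H 1 + θ ∧ empAcc D h = 1)
    {h : X → Bool} (hmin : IsEmpiricalMinimiser F H δ D h) :
    gap P F H h ≤ 2 * L * α + 2 * β + θ := by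
  obtain ⟨⟨hH, hδ⟩, hopt⟩ := hmin
  have hα0 : 0 ≤ α := (abs_nonneg _).trans (hα h hH)
  have hβ0 : 0 ≤ β := (abs_nonneg _).trans (hβ h hH)
  have hcmp : ∀ h' ∈ H, empAcc D h ≤ empAcc D h' → fair P F h ≤ fair P F h' + 2 * β := by
    intro h' hh' hle
    have h1 := abs_le.1 (hβ h hH)
    have h2 := abs_le.1 (hβ h' hh')
    linarith [hopt h' hh' (hδ.trans hle), h1.1, h2.2]
  -- a competitor bound at a nearby accuracy level suffices
  have hsuff : ∀ ψ ∈ Set.Icc (0 : ℝ) 1, |ψ - acc P h| ≤ 2 * α →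
      fair P F h ≤ tradeoff P F H ψ + 2 * β + θ → gap P F H h ≤ 2 * L * α + 2 * β + θ := by
    intro ψ hψ hd hle
    have hl := hLip.dist_le_mul ψ hψ (acc P h) (acc_mem_Icc P h)
    rw [Real.dist_eq, Real.dist_eq] at hl
    have h1 := (le_abs_self _).trans (hl.trans (mul_le_mul_of_nonneg_left hd L.2))
    unfold gap
    change _ ≤ (L : ℝ) * _ at h1
    linarith
  rcases le_or_gt (acc P h + 2 * α) 1 with hcase | hcase
  -- One α covers the accuracy error of h and the other that of the competitor, which therefore has
  -- at least the empirical accuracy of h and is feasible for every δ. If the level is unattainable,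
  -- the curve is 1 there and the bound on Φ suffices.
  · refine hsuff (acc P h + 2 * α) ⟨by linarith [(acc_mem_Icc P h).1], hcase⟩
      (by rw [add_sub_cancel_left, abs_of_nonneg (by linarith)]) ?_
    by_cases hex : ∃ h' ∈ H, acc P h + 2 * α ≤ acc P h'
    · have : fair P F h - 2 * β ≤ tradeoff P F H (acc P h + 2 * α) := by
        rw [tradeoff, if_pos hex]
        obtain ⟨h', hh', hacc⟩ := hex
        refine le_csInf ⟨_, h', ⟨hh', hacc⟩, rfl⟩ ?_
        rintro _ ⟨k, ⟨hk, hkacc⟩, rfl⟩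
        have h1 := abs_le.1 (hα h hH)
        have h2 := abs_le.1 (hα k hk)
        linarith [hcmp k hk (by linarith [h1.2, h2.1])]
      linarith
    · rw [tradeoff, if_neg hex]
      linarith [hfair h hH]
  · refine hsuff 1 ⟨zero_le_one, le_rfl⟩ ?_ ?_
    · rw [abs_of_nonneg (by linarith [(acc_mem_Icc P h).2])]
      linarith
    by_cases hex : ∃ h' ∈ H, 1 ≤ acc P h'
    · obtain ⟨k, hk, hkf, hk1⟩ := hone hex
      linarith [hcmp k hk (hk1 ▸ empAcc_le_one D h)]
    · rw [tradeoff, if_neg hex]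
      linarith [hfair h hH]

/-- If perfect accuracy is attainable, then almost every sample admits a near-optimal competitor
of empirical accuracy `1`. -/
theorem exists_measurableSet_competitor (P : Measure (X × A × Bool)) [IsProbabilityMeasure P]
    (F : FairnessMetric X A m) {H : Set (X → Bool)} (hH : ∀ h ∈ H, Measurable h) {n : ℕ}
    (hn : 1 ≤ n) {θ : ℝ} (hθ : 0 < θ) :
    ∃ G : Set (Fin n → X × A × Bool), MeasurableSet G ∧
      (∀ᵐ D ∂(Measure.pi fun _ : Fin n => P), D ∈ G) ∧
      ∀ D ∈ G, (∃ h ∈ H, 1 ≤ acc P h) →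
        ∃ h ∈ H, fair P F h ≤ tradeoff P F H 1 + θ ∧ empAcc D h = 1 := by
  by_cases hex : ∃ h ∈ H, 1 ≤ acc P h
  -- The infimum need not be attained, hence the slack θ. The competitor is fixed before the sample
  -- is drawn, so a single null set is excluded.
  · obtain ⟨_, ⟨k, ⟨hk, hk1⟩, rfl⟩, hlt⟩ := exists_lt_of_csInf_lt
      (s := fair P F '' {h | h ∈ H ∧ 1 ≤ acc P h})
      (by obtain ⟨h, hh, h1⟩ := hex; exact ⟨_, h, ⟨hh, h1⟩, rfl⟩) (lt_add_of_pos_right _ hθ)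
    have hkm := measurableSet_correct (A := A) (hH k hk)
    have hae : ∀ᵐ z ∂P, k z.1 = z.2.2 := by
      have h1 : P.real {z | k z.1 = z.2.2} = 1 := le_antisymm measureReal_le_one hk1
      have h2 := probReal_compl_eq_one_sub (μ := P) hkm
      rw [h1, sub_self, measureReal_eq_zero_iff] at h2
      exact h2
    refine ⟨⋂ i, Function.eval i ⁻¹' {z | k z.1 = z.2.2},
      MeasurableSet.iInter fun i => measurable_pi_apply i hkm, ?_, fun D hD _ =>
        ⟨k, hk, ?_, ?_⟩⟩
    · simp only [Set.mem_iInter]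
      exact ae_all_iff.2 fun i =>
        (measurePreserving_eval (fun _ : Fin n => P) i).quasiMeasurePreserving.ae hae
    · rw [tradeoff, if_pos hex]
      exact hlt.le
    · have hD' : ∀ i, k (D i).1 = (D i).2.2 := Set.mem_iInter.1 hD
      have hn0 : (n : ℝ) ≠ 0 := by exact_mod_cast (by omega : n ≠ 0)
      simp [empAcc, hD', hn0]
  · exact ⟨Set.univ, MeasurableSet.univ, by simp, fun D _ h => absurd h hex⟩

/-! ### Rates and constants. -/

/-- The deviation term at confidence `η` after a union bound over `N` events, with a linear
dependence on `log (1 / η)`. -/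
theorem sqrt_log_div_le {N η γ : ℝ} (hN : 1 ≤ N) (hη0 : 0 < η) (hη1 : η < 1) (hγ : γ ≤ 1 / 2)
    {n : ℕ} (hn : 1 ≤ n) :
    √(2 * Real.log (N / η) / n) ≤
      2 * (1 + Real.log N) * (1 + Real.log (1 / η)) * (n : ℝ) ^ (-γ) := by
  have hn1 : (1 : ℝ) ≤ n := by exact_mod_cast hn
  have hlN : 0 ≤ Real.log N := Real.log_nonneg hN
  have hl : 0 ≤ Real.log (1 / η) := Real.log_nonneg ((one_le_div hη0).2 hη1.le)
  have hsplit : Real.log (N / η) = Real.log N + Real.log (1 / η) := by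
    rw [div_eq_mul_one_div, Real.log_mul (by positivity) (by positivity)]
  rw [hsplit, Real.sqrt_div' _ (by positivity), div_eq_mul_inv]
  -- The place where γ ≤ 1/2 enters: the concentration rate is no slower than n^(-γ).
  have h1 : (√(n : ℝ))⁻¹ ≤ (n : ℝ) ^ (-γ) := by
    rw [Real.sqrt_eq_rpow, ← Real.rpow_neg (by positivity)]
    exact Real.rpow_le_rpow_of_exponent_le hn1 (by linarith)
  have h2 : √(2 * (Real.log N + Real.log (1 / η))) ≤
      2 * (1 + Real.log N) * (1 + Real.log (1 / η)) := by
    refine Real.sqrt_le_iff.2 ⟨by positivity, ?_⟩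
    have : 0 ≤ Real.log N * Real.log (1 / η) := by positivity
    nlinarith [sq_nonneg (Real.log N * Real.log (1 / η)),
      sq_nonneg ((1 + Real.log N) * (1 + Real.log (1 / η)) - 1)]
  exact mul_le_mul h2 h1 (by positivity) (by positivity)

/-- The functions of the data point and the prediction whose empirical means determine the
empirical accuracy and the empirical fairness violation. -/
noncomputable def statistic (F : FairnessMetric X A m) :
    Option (Fin m ⊕ Fin m) → X × A × Bool → Bool → ℝ
  | none, z, y => if y = z.2.2 then 1 else 0
  | some (Sum.inl j), z, y => (F.event j).indicator (fun z => F.g j z y) z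
  | some (Sum.inr j), z, _ => (F.event j).indicator (fun _ => 1) z

theorem measurable_statistic (F : FairnessMetric X A m) (k : Option (Fin m ⊕ Fin m)) (y : Bool) :
    Measurable fun z => statistic F k z y := by
  match k with
  | none =>
    exact Measurable.ite (measurableSet_correct (h := fun _ => y) measurable_const)
      measurable_const measurable_const
  | some (Sum.inl j) => exact (F.measurable_g j y).indicator (F.measurableSet_event j)
  | some (Sum.inr j) => exact measurable_const.indicator (F.measurableSet_event j)

theorem abs_statistic_le (F : FairnessMetric X A m) {b : ℝ} (hb1 : 1 ≤ b)
    (hb : ∀ j z y, |F.g j z y| ≤ b) (k : Option (Fin m ⊕ Fin m)) (z : X × A × Bool) (y : Bool) :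
    |statistic F k z y| ≤ b := by
  have hb0 : 0 ≤ b := zero_le_one.trans hb1
  match k with
  | none =>
    simp only [statistic]
    split_ifs <;> simpa
  | some (Sum.inl j) =>
    by_cases hz : z ∈ F.event j
    · simpa [statistic, hz] using hb j z y
    · simpa [statistic, hz] using hb0
  | some (Sum.inr j) =>
    by_cases hz : z ∈ F.event j
    · simpa [statistic, hz] using hb1
    · simpa [statistic, hz] using hb0

end FairTradeoff

open FairTradeoff in
theorem theorem3p4 (L : NNReal) (C γ B p : ℝ) (m : ℕ) (hC : 0 ≤ C) (hγ : γ ≤ 1 / 2)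
    (hp : 0 < p) :
    ∃ (K : ℝ) (k : ℕ), ∀ (X : Type*) (A : Type*) [MeasurableSpace X] [MeasurableSpace A]
      (P : MeasureTheory.Measure (X × A × Bool)) [MeasureTheory.IsProbabilityMeasure P]
      (F : FairTradeoff.FairnessMetric X A m) (H : Set (X → Bool)),
      (∀ h ∈ H, Measurable h) →
      (∀ j z b, |F.g j z b| ≤ B) →
      (∀ j, p ≤ P.real (F.event j)) →
      (∀ h ∈ H, FairTradeoff.fair P F h ≤ 1) →
      LipschitzOnWith L (FairTradeoff.tradeoff P F H) (Set.Icc 0 1) →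
      ∀ n : ℕ, 1 ≤ n →
      FairTradeoff.rademacherComplexity (P.map Prod.fst) H n ≤ C * (n : ℝ) ^ (-γ) →
      ∀ (δ η : ℝ), 0 < η → η < 1 →
      ∃ G : Set (Fin n → X × A × Bool), MeasurableSet G ∧
        1 - η ≤ (MeasureTheory.Measure.pi fun _ : Fin n => P).real G ∧
        ∀ D ∈ G, ∀ h, FairTradeoff.IsEmpiricalMinimiser F H δ D h →
          FairTradeoff.gap P F H h ≤ K * (1 + Real.log (1 / η)) ^ k * (n : ℝ) ^ (-γ) := by
  -- One positive bound for the functions g_j and the indicators alike. N counts the 2m + 1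
  -- statistics with both signs.
  set b := max B 1 with hbdef
  set N : ℝ := 2 * Fintype.card (Option (Fin m ⊕ Fin m)) with hNdef
  set K₀ : ℝ := 4 * b * C + 2 * b * (2 * (1 + Real.log N)) with hK₀
  -- The three terms are the Lipschitz cost 2Lα, the fairness error 2β and the slack θ = n^(-γ). The
  -- exponent is 1 because the square root of the logarithm is bounded linearly.
  refine ⟨2 * L * K₀ + 2 * (m * (K₀ * (1 + b) / p)) + 1, 1, ?_⟩
  intro X A _ _ P _ F H hH hB hpe hfair hLip n hn hR δ η hη0 hη1
  have hb1 : 1 ≤ b := le_max_right _ _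
  have hb0 : 0 < b := zero_lt_one.trans_le hb1
  have hgb : ∀ j z y, |F.g j z y| ≤ b := fun j z y => (hB j z y).trans (le_max_left _ _)
  have hN1 : 1 ≤ N := by
    have : (1 : ℝ) ≤ Fintype.card (Option (Fin m ⊕ Fin m)) := by
      exact_mod_cast Fintype.card_pos (α := Option (Fin m ⊕ Fin m))
    linarith
  set Λ := 1 + Real.log (1 / η) with hΛ
  have hΛ1 : 1 ≤ Λ := by
    have := Real.log_nonneg ((one_le_div hη0).2 hη1.le)
    linarith
  set r := (n : ℝ) ^ (-γ) with hr
  have hr0 : 0 < r := Real.rpow_pos_of_pos (by exact_mod_cast hn) _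
  obtain ⟨G, hGm, hGp, hG⟩ := exists_measurableSet_uniform_abs_deviation P measurable_fst hH hn
    (measurable_statistic F) hb0 (abs_statistic_le F hb1 hgb) hη0 hη1.le
  obtain ⟨G', hG'm, hG'p, hG'⟩ := exists_measurableSet_competitor P F hH hn hr0
  refine ⟨G ∩ G', hGm.inter hG'm, hGp.trans (le_of_eq ?_), fun D hD h hmin => ?_⟩
  -- The competitor event has full measure, so intersecting with it costs no confidence.
  · exact (measureReal_congr (inter_ae_eq_left_of_ae_eq_univ (Filter.eventuallyEq_univ.2 hG'p))).symm
  have hdev : ∀ h ∈ H, ∀ k, |(∑ i, statistic F k (D i) (h (D i).1)) / n -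
      ∫ z, statistic F k z (h z.1) ∂P| ≤ K₀ * Λ * r := by
    intro h hh k
    refine (hG D hD.1 h hh k).trans ?_
    have h1 := sqrt_log_div_le hN1 hη0 hη1 hγ hn
    have h2 : C * r ≤ C * Λ * r := by
      have : C ≤ C * Λ := le_mul_of_one_le_right hC hΛ1
      gcongr
    calc _ ≤ 4 * b * (C * Λ * r) + 2 * b * (2 * (1 + Real.log N) * Λ * r) := by
          gcongr
          exact hR.trans h2
      _ = _ := by ring
  have hα : ∀ h ∈ H, |empAcc D h - acc P h| ≤ K₀ * Λ * r := fun h hh => by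
    rw [acc_eq_integral P (hH h hh)]
    exact hdev h hh none
  have hβ : ∀ h ∈ H, |empFair F D h - fair P F h| ≤ m * (K₀ * Λ * r * (1 + b) / p) :=
    fun h hh => by
      refine abs_empFair_sub_fair_le P F hb0.le hgb hp hpe hn D h
        (fun j => hdev h hh (some (Sum.inl j))) fun j => ?_
      rw [← integral_indicator_one (F.measurableSet_event j)]
      exact hdev h hh (some (Sum.inr j))
  refine (gap_le_of_uniform_close hfair hLip hr0.le hα hβ (hG' D hD.2) hmin).trans ?_
  have hrΛ : r ≤ Λ * r := le_mul_of_one_le_left hr0.le hΛ1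
  calc _ ≤ 2 * L * (K₀ * Λ * r) + 2 * (m * (K₀ * Λ * r * (1 + b) / p)) + Λ * r := by gcongr
    _ = _ := by ring
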